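/- A partial function on $n$ bits is a map $f:\{0,1\}^n\times\{0,1\}^n\to\{0,1,?\}$, where $?$ means that $f$ is undefined at that input; $f$ is permutation-invariant if $f(x^\pi,y^\pi)=f(x,y)$ for all $x,y\in\{0,1\}^n$ and every permutation $\pi$ of the $n$ coordinates, where $(x^\pi)_i=x_{\pi(i)}$. A two-party randomized protocol (with public and private randomness) computes $f$ if it outputs $f(x,y)$ with probability at least $2/3$ on every input $(x,y)$ with $f(x,y)\neq{?}$. Let $R(f)$ be the minimum, over all protocols $\Pi$ computing $f$, of the worst-case number of bits exchanged by $\Pi$, and let $$\mathrm{IC}(f)=\inf_{\Pi}\ \sup_{\mu}\ \bigl(I(X;\Pi\mid Y)+I(Y;\Pi\mid X)\bigr),$$ where $\Pi$ ranges over the protocols computing $f$, $\mu$ ranges over all distributions of $(X,Y)$ on $\{0,1\}^n\times\{0,1\}^n$, and inside the conditional mutual information (in bits) $\Pi$ denotes the transcript (the public coins together with all exchanged bits). Let $G:\mathbb R\to\mathbb R$ be a function and let $p$ be a real polynomial such that $$R(f)\le p(\mathrm{IC}(f))+G(\log_2 n)$$ for every $n\ge 1$ and every permutation-invariant partial function $f$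 on $n$ bits. Then $$R(g)\le p(\mathrm{IC}(g))+G(n)$$ for every $n$ and every partial function $g$ on $n$ bits. (In particular, if a bound $R(f)\le\mathrm{poly}(\mathrm{IC}(f))+G(\log_2 n)$ holds for permutation-invariant partial functions, then $R(g)\le\mathrm{poly}(\mathrm{IC}(g))+G(n)$ for all partial functions, even with the same polynomial.) -/

import Mathlib

/-! ### Entropy and conditional mutual information (in bits) -/

/-- Shannon entropy, in bits, of a discrete distribution. It is only used for distributions of
finite support, for which the sum has finitely many nonzero terms. -/
noncomputable def shannonEntropy {A : Type} (p : PMF A) : ℝ :=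
  (∑' a, Real.negMulLog (p a).toReal) / Real.log 2

/-- The conditional entropy `H(A | B) = H(A, B) - H(B)` for a joint law `p` of `(A, B)`. -/
noncomputable def condEntropy {A B : Type} (p : PMF (A × B)) : ℝ :=
  shannonEntropy p - shannonEntropy (p.map Prod.snd)

/-- The conditional mutual information `I(A ; B | C) = H(A | C) - H(A | B, C)` for a joint
law `p` of `(A, B, C)`. -/
noncomputable def condMutualInfo {A B C : Type} (p : PMF (A × B × C)) : ℝ :=
  condEntropy (p.map fun t => (t.1, t.2.2)) - condEntropy p

/-! ### Two-party communication protocols -/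

/-- A two-party protocol tree with private randomness, for inputs in `X` (Alice) and `Y` (Bob).
An internal node is owned by one of the players, who sends one bit, drawn from a distribution
depending on that player's own input (and on the node, i.e. on the bits exchanged so far).
A leaf carries the output. -/
inductive PrivateCoinProtocol (X Y : Type) : Type
  | leaf (out : Bool) : PrivateCoinProtocol X Y
  | alice (msg : X → PMF Bool) (next : Bool → PrivateCoinProtocol X Y) : PrivateCoinProtocol X Y
  | bob (msg : Y → PMF Bool) (next : Bool → PrivateCoinProtocol X Y) : PrivateCoinProtocol X Y

namespace PrivateCoinProtocol

/-- The maximal number of bits exchanged. -/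
def depth {X Y : Type} : PrivateCoinProtocol X Y → ℕ
  | leaf _ => 0
  | alice _ next => 1 + max (depth (next false)) (depth (next true))
  | bob _ next => 1 + max (depth (next false)) (depth (next true))

/-- The joint law of the sequence of exchanged bits and of the output on input `(x, y)`. -/
noncomputable def run {X Y : Type} :
    PrivateCoinProtocol X Y → X → Y → PMF (List Bool × Bool)
  | leaf out, _, _ => PMF.pure ([], out)
  | alice msg next, x, y =>
      (msg x).bind fun b => (run (next b) x y).map fun t => (b :: t.1, t.2)
  | bob msg next, x, y =>
      (msg y).bind fun b => (run (next b) x y).map fun t => (b :: t.1, t.2)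

end PrivateCoinProtocol

/-- A randomized protocol with public and private randomness: the public coins are an element
of a finite set, drawn from an arbitrary distribution and seen by both players, who then run
the corresponding private-coin protocol. -/
structure RandomizedProtocol (X Y : Type) : Type where
  numSeeds : ℕ
  coins : PMF (Fin numSeeds)
  tree : Fin numSeeds → PrivateCoinProtocol X Y

namespace RandomizedProtocol

/-- The communication cost: the number of exchanged bits in the worst case. -/
def cost {X Y : Type} (P : RandomizedProtocol X Y) : ℕ :=
  Finset.univ.sup fun r => (P.tree r).depth

/-- The law of the output on input `(x, y)`. -/
noncomputable def output {X Y : Type} (P : RandomizedProtocol X Y) (x : X) (y : Y) : PMF Bool :=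
  P.coins.bind fun r => ((P.tree r).run x y).map Prod.snd

/-- The law of the transcript on input `(x, y)`: the public coins together with all the bits
exchanged. -/
noncomputable def transcript {X Y : Type} (P : RandomizedProtocol X Y) (x : X) (y : Y) :
    PMF (Fin P.numSeeds × List Bool) :=
  P.coins.bind fun r => ((P.tree r).run x y).map fun t => (r, t.1)

/-- The joint law of `(X, Y, Π)` when the inputs `(X, Y)` have law `μ` and `Π` is the
transcript. -/
noncomputable def jointLaw {X Y : Type} (P : RandomizedProtocol X Y) (μ : PMF (X × Y)) :
    PMF (X × Y × (Fin P.numSeeds × List Bool)) :=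
  μ.bind fun z => (P.transcript z.1 z.2).map fun t => (z.1, z.2, t)

/-- The internal information cost `I(X ; Π | Y) + I(Y ; Π | X)` under the input law `μ`. -/
noncomputable def infoCost {X Y : Type} (P : RandomizedProtocol X Y) (μ : PMF (X × Y)) : ℝ :=
  condMutualInfo ((P.jointLaw μ).map fun t => (t.1, t.2.2, t.2.1)) +
    condMutualInfo ((P.jointLaw μ).map fun t => (t.2.1, t.2.2, t.1))

end RandomizedProtocol

/-! ### Partial functions on pairs of bit strings and their complexities -/

/-- Partial functions `{0,1}^n × {0,1}^n → {0,1,?}`; the value `?` is `none`. -/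
abbrev PartialBoolFun (n : ℕ) : Type := (Fin n → Bool) → (Fin n → Bool) → Option Bool

namespace PartialBoolFun

/-- `f(x^π, y^π) = f(x, y)` for all permutations `π` of the coordinates. -/
def PermInvariant {n : ℕ} (f : PartialBoolFun n) : Prop :=
  ∀ (π : Equiv.Perm (Fin n)) (x y : Fin n → Bool), f (x ∘ π) (y ∘ π) = f x y

/-- The protocol `P` outputs `f(x, y)` with probability at least `2/3` on every input `(x, y)`
on which `f` is defined. -/
def ComputedBy {n : ℕ} (f : PartialBoolFun n)
    (P : RandomizedProtocol (Fin n → Bool) (Fin n → Bool)) : Prop :=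
  ∀ (x y : Fin n → Bool) (b : Bool), f x y = some b → 2 / 3 ≤ (P.output x y b).toReal

/-- The randomized communication complexity `R(f)`. -/
noncomputable def R {n : ℕ} (f : PartialBoolFun n) : ℕ :=
  sInf {c : ℕ | ∃ P, f.ComputedBy P ∧ P.cost = c}

/-- The prior-free information complexity `IC(f)`: the infimum over the protocols computing `f`
of the supremum over all input distributions of the information cost. The infimum and the
supremum are formed in the extended reals; the value is finite. -/
noncomputable def IC {n : ℕ} (f : PartialBoolFun n) : ℝ :=
  (⨅ (P : RandomizedProtocol (Fin n → Bool) (Fin n → Bool)) (_ : f.ComputedBy P),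
    ⨆ μ : PMF ((Fin n → Bool) × (Fin n → Bool)), (P.infoCost μ : EReal)).toReal

end PartialBoolFun

/-!
A function `g` on `n` bits becomes permutation-invariant on `2 ^ n` bits when each input is read off
from the Hamming weight of a longer string, because the weights realize at least `2 ^ n` values; and
`log₂ (2 ^ n) = n`. Writing `d` for this decoding, the players turn a protocol for `g` into one for
the new function by applying `d` to their inputs, and conversely by applying a right inverse of `d`,
at no cost in bits. Neither translation increases the information cost: a transcript `Π` that
depends on the inputs only through `(φ X, ψ Y)` satisfies `H(Π | X, Y) = H(Π | φ X, ψ Y)` and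
`H(Π | Y) ≤ H(Π | ψ Y)`, hence `I(X ; Π | Y) ≤ I(φ X ; Π | ψ Y)`. So `R` and `IC` are unchanged.
-/

/-! ### Entropy -/

theorem mul_log_sub_log_le {x y : ℝ} (hx : 0 ≤ x) (hy : 0 ≤ y) (hxy : y = 0 → x = 0) :
    x * (Real.log y - Real.log x) ≤ y - x := by
  obtain rfl | hx := hx.eq_or_lt
  · simpa using hy
  · have hy : 0 < y := hy.lt_of_ne' fun h => hx.ne' (hxy h)
    calc x * (Real.log y - Real.log x)
        = x * Real.log (y / x) := by rw [Real.log_div hy.ne' hx.ne']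
      _ ≤ x * (y / x - 1) :=
        mul_le_mul_of_nonneg_left (Real.log_le_sub_one_of_pos (div_pos hy hx)) hx.le
      _ = y - x := by field_simp

section Expectation

variable {A B : Type*}

theorem sum_toReal_le_one (p : PMF A) (s : Finset A) : ∑ a ∈ s, (p a).toReal ≤ 1 := by
  rw [← ENNReal.toReal_sum fun a _ => p.apply_ne_top a, ← ENNReal.toReal_one]
  exact ENNReal.toReal_mono ENNReal.one_ne_top
    ((ENNReal.sum_le_tsum s).trans_eq p.tsum_coe)

theorem sum_toReal_eq_one (p : PMF A) {s : Finset A} (hs : p.support ⊆ s) :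
    ∑ a ∈ s, (p a).toReal = 1 := by
  have hzero : ∀ a ∉ s, p a = 0 := fun a ha => (p.apply_eq_zero_iff a).2 fun h => ha (hs h)
  rw [← ENNReal.toReal_sum fun a _ => p.apply_ne_top a, ← tsum_eq_sum (L := .unconditional A) hzero,
    p.tsum_coe, ENNReal.toReal_one]

theorem sum_toReal_le_toReal_map (p : PMF A) (f : A → B) {s : Finset A} {b : B}
    (hs : ∀ a ∈ s, f a = b) : ∑ a ∈ s, (p a).toReal ≤ (p.map f b).toReal := by
  rw [← ENNReal.toReal_sum fun a _ => p.apply_ne_top a]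
  refine ENNReal.toReal_mono ((p.map f).apply_ne_top b) ?_
  rw [PMF.map_apply]
  refine (Finset.sum_le_sum fun a ha => ?_).trans (ENNReal.sum_le_tsum s)
  rw [if_pos (hs a ha).symm]

theorem toReal_map_apply_pos (p : PMF A) (f : A → B) {a : A} (ha : p a ≠ 0) :
    0 < (p.map f (f a)).toReal :=
  ENNReal.toReal_pos ((PMF.mem_support_map_iff ..).2 ⟨a, ha, rfl⟩) ((p.map f).apply_ne_top _)

theorem tsum_toReal_map_mul (p : PMF A) {s : Finset A} (hs : p.support ⊆ s) (f : A → B)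
    (F : B → ℝ) : ∑' b, (p.map f b).toReal * F b = ∑ a ∈ s, (p a).toReal * F (f a) := by
  classical
  have hfiber (b : B) : (p.map f b).toReal * F b =
      ∑ a ∈ s, if b = f a then (p a).toReal * F (f a) else 0 := by
    rw [PMF.map_apply, tsum_eq_sum fun a ha => by
      rw [(p.apply_eq_zero_iff a).2 fun h => ha (hs h), ite_self],
      ENNReal.toReal_sum fun a _ => by split_ifs <;> simp [p.apply_ne_top], Finset.sum_mul]
    refine Finset.sum_congr rfl fun a _ => ?_
    split_ifs with h <;> simp [h]
  simp only [hfiber]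
  rw [Summable.tsum_finsetSum fun a _ => (hasSum_ite_eq (f a) _).summable]
  simp only [tsum_ite_eq]

end Expectation

theorem shannonEntropy_map_eq_sum {A B : Type} (p : PMF A) {s : Finset A} (hs : p.support ⊆ s)
    (f : A → B) : shannonEntropy (p.map f) =
      (∑ a ∈ s, (p a).toReal * -Real.log (p.map f (f a)).toReal) / Real.log 2 := by
  rw [shannonEntropy, ← tsum_toReal_map_mul p hs f fun b => -Real.log (p.map f b).toReal]
  simp only [Real.negMulLog, neg_mul, mul_neg]

theorem shannonEntropy_map_equiv {A B : Type} (p : PMF A) (e : A ≃ B) :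
    shannonEntropy (p.map e) = shannonEntropy p := by
  have happly (a : A) : p.map e (e a) = p a := by
    rw [PMF.map_apply, tsum_eq_single a fun a' ha' => if_neg (e.injective.ne ha'.symm), if_pos rfl]
  simp only [shannonEntropy, ← e.tsum_eq fun b => Real.negMulLog (p.map e b).toReal, happly]

theorem condEntropy_map_prodMap_equiv {B C D : Type} (q : PMF (B × C)) (e : C ≃ D) :
    condEntropy (q.map (Prod.map id e)) = condEntropy q := by
  have hjoint : shannonEntropy (q.map (Prod.map id e)) = shannonEntropy q :=
    shannonEntropy_map_equiv q ((Equiv.refl B).prodCongr e)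
  have hsnd : (q.map (Prod.map id e)).map Prod.snd = (q.map Prod.snd).map e := by
    rw [PMF.map_comp, PMF.map_comp]
    rfl
  rw [condEntropy, condEntropy, hjoint, hsnd, shannonEntropy_map_equiv]

theorem condMutualInfo_eq_condEntropy_sub {A B C : Type} (p : PMF (A × B × C)) :
    condMutualInfo p =
      condEntropy (p.map Prod.snd) - condEntropy (p.map fun t => (t.2.1, t.1, t.2.2)) := by
  let e : A × B × C ≃ B × A × C :=
    ⟨fun t => (t.2.1, t.1, t.2.2), fun t => (t.2.1, t.1, t.2.2), fun _ => rfl, fun _ => rfl⟩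
  have hjoint : shannonEntropy (p.map fun t => (t.2.1, t.1, t.2.2)) = shannonEntropy p :=
    shannonEntropy_map_equiv p e
  simp only [condMutualInfo, condEntropy, PMF.map_comp, Function.comp_def, hjoint]
  ring

section CondProb

variable {B C D : Type*}

/-- The conditional probability that `B = z.1` given `C = z.2`, for a joint law `q` of `(B, C)`.
It is `0` where `C = z.2` has probability `0`. -/
noncomputable def condProb (q : PMF (B × C)) (z : B × C) : ℝ :=
  (q z).toReal / (q.map Prod.snd z.2).toReal

theorem condProb_nonneg (q : PMF (B × C)) (z : B × C) : 0 ≤ condProb q z := by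
  unfold condProb
  positivity

theorem condProb_pos (q : PMF (B × C)) {z : B × C} (hz : q z ≠ 0) : 0 < condProb q z :=
  div_pos (ENNReal.toReal_pos hz (q.apply_ne_top z)) (toReal_map_apply_pos q Prod.snd hz)

theorem toReal_map_snd_mul_condProb (q : PMF (B × C)) (z : B × C) :
    (q.map Prod.snd z.2).toReal * condProb q z = (q z).toReal := by
  refine mul_div_cancel_of_imp' fun hsnd => ?_
  by_contra hz
  exact (toReal_map_apply_pos q Prod.snd (ENNReal.toReal_ne_zero.1 hz).1).ne' hsnd

theorem sum_condProb_le_one (q : PMF (B × C)) (s : Finset B) (c : C) :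
    ∑ b ∈ s, condProb q (b, c) ≤ 1 := by
  simp only [condProb, ← Finset.sum_div]
  refine div_le_one_of_le₀ ?_ ENNReal.toReal_nonneg
  classical
  simpa using sum_toReal_le_toReal_map q Prod.snd (s := s ×ˢ {c}) (b := c) (by simp)

theorem sum_mul_condProb_le_one (p : PMF C) (r : PMF (B × D)) (ψ : C → D) (s : Finset (B × C)) :
    ∑ z ∈ s, (p z.2).toReal * condProb r (z.1, ψ z.2) ≤ 1 := by
  classical
  calc ∑ z ∈ s, (p z.2).toReal * condProb r (z.1, ψ z.2)
      ≤ ∑ z ∈ s.image Prod.fst ×ˢ s.image Prod.snd,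
          (p z.2).toReal * condProb r (z.1, ψ z.2) :=
        Finset.sum_le_sum_of_subset_of_nonneg Finset.subset_product fun z _ _ =>
          mul_nonneg ENNReal.toReal_nonneg (condProb_nonneg r _)
    _ = ∑ c ∈ s.image Prod.snd,
          (p c).toReal * ∑ b ∈ s.image Prod.fst, condProb r (b, ψ c) := by
        simp only [Finset.sum_product_right, Finset.mul_sum]
    _ ≤ ∑ c ∈ s.image Prod.snd, (p c).toReal :=
        Finset.sum_le_sum fun c _ =>
          mul_le_of_le_one_right ENNReal.toReal_nonneg (sum_condProb_le_one r _ _)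
    _ ≤ 1 := sum_toReal_le_one p _

end CondProb

theorem condEntropy_map_eq_sum {A B C : Type} (p : PMF A) {s : Finset A} (hs : p.support ⊆ s)
    (f : A → B × C) : condEntropy (p.map f) =
      (∑ a ∈ s, (p a).toReal * -Real.log (condProb (p.map f) (f a))) / Real.log 2 := by
  rw [condEntropy, PMF.map_comp, shannonEntropy_map_eq_sum p hs f,
    shannonEntropy_map_eq_sum p hs (Prod.snd ∘ f), ← sub_div, ← Finset.sum_sub_distrib]
  congr 1
  refine Finset.sum_congr rfl fun a _ => ?_
  obtain ha | ha := eq_or_ne (p a) 0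
  · simp [ha]
  · have hsnd : 0 < (p.map (Prod.snd ∘ f) (f a).2).toReal := toReal_map_apply_pos p _ ha
    rw [condProb, PMF.map_comp, Real.log_div (toReal_map_apply_pos p f ha).ne' hsnd.ne',
      Function.comp_apply]
    ring

theorem condEntropy_eq_sum {B C : Type} (q : PMF (B × C)) {s : Finset (B × C)}
    (hs : q.support ⊆ s) :
    condEntropy q = (∑ z ∈ s, (q z).toReal * -Real.log (condProb q z)) / Real.log 2 := by
  simpa only [PMF.map_id, id_eq] using condEntropy_map_eq_sum q hs id

/- Gibbs' inequality, comparing `q` with the law of `(B', C)`, where `B'` is distributed as `B`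
conditioned on `ψ C`. -/
theorem condEntropy_le_condEntropy_map {B C D : Type} (q : PMF (B × C)) (hq : q.support.Finite)
    (ψ : C → D) : condEntropy q ≤ condEntropy (q.map (Prod.map id ψ)) := by
  have hs : q.support ⊆ hq.toFinset := hq.coe_toFinset.ge
  set r := q.map (Prod.map id ψ) with hr
  have hpointwise (z : B × C) :
      (q z).toReal * (Real.log (condProb r (z.1, ψ z.2)) - Real.log (condProb q z)) ≤
        (q.map Prod.snd z.2).toReal * condProb r (z.1, ψ z.2) - (q z).toReal := by
    have hac : condProb r (z.1, ψ z.2) = 0 → condProb q z = 0 := fun hrz => by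
      by_contra hqz
      have hz : q z ≠ 0 := fun h => hqz (by simp [condProb, h])
      exact (condProb_pos r ((PMF.mem_support_map_iff ..).2 ⟨z, hz, rfl⟩)).ne' hrz
    rw [← toReal_map_snd_mul_condProb q z, mul_assoc, ← mul_sub]
    exact mul_le_mul_of_nonneg_left
      (mul_log_sub_log_le (condProb_nonneg q z) (condProb_nonneg r _) hac) ENNReal.toReal_nonneg
  have hsum := Finset.sum_le_sum fun z (_ : z ∈ hq.toFinset) => hpointwise z
  simp only [Finset.sum_sub_distrib, mul_sub, sum_toReal_eq_one q hs] at hsum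
  rw [condEntropy_eq_sum q hs, hr, condEntropy_map_eq_sum q hs]
  refine div_le_div_of_nonneg_right ?_ (Real.log_nonneg one_le_two)
  simp only [mul_neg, Finset.sum_neg_distrib, Prod.map_apply', id_eq, ← hr]
  linarith [sum_mul_condProb_le_one (q.map Prod.snd) r ψ hq.toFinset]

section Channel

variable {B I J : Type*}

/-- The joint law of the output and the input of the channel `W` when the input has law `μ`.
The output comes first, so that `condEntropy` conditions on the input. -/
noncomputable def channelLaw (μ : PMF I) (W : I → PMF B) : PMF (B × I) :=
  μ.bind fun i => (W i).map fun b => (b, i)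

theorem channelLaw_apply (μ : PMF I) (W : I → PMF B) (b : B) (i : I) :
    channelLaw μ W (b, i) = μ i * W i b := by
  classical
  have hmap (i' : I) : (W i').map (fun b => (b, i')) (b, i) = if i' = i then W i b else 0 := by
    split_ifs with h
    · subst h
      simp [PMF.map_apply]
    · simp [PMF.map_apply, Ne.symm h]
  simp only [channelLaw, PMF.bind_apply, hmap, mul_ite, mul_zero, tsum_ite_eq]

theorem channelLaw_map_snd (μ : PMF I) (W : I → PMF B) : (channelLaw μ W).map Prod.snd = μ := by
  rw [channelLaw, PMF.map_bind]
  simp only [PMF.map_comp, Function.comp_def]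
  exact (congrArg μ.bind (funext fun i => PMF.map_const _ i)).trans μ.bind_pure

theorem channelLaw_map_prodMap (μ : PMF I) (W : J → PMF B) (φ : I → J) :
    (channelLaw μ (W ∘ φ)).map (Prod.map id φ) = channelLaw (μ.map φ) W := by
  simp only [channelLaw, PMF.map_bind, PMF.bind_map, PMF.map_comp, Function.comp_def,
    Prod.map_apply, id_eq]

theorem condProb_channelLaw (μ : PMF I) (W : I → PMF B) (b : B) {i : I} (hi : μ i ≠ 0) :
    condProb (channelLaw μ W) (b, i) = (W i b).toReal := by
  rw [condProb, channelLaw_map_snd, channelLaw_apply, ENNReal.toReal_mul]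
  exact mul_div_cancel_left₀ _ (ENNReal.toReal_ne_zero.2 ⟨hi, μ.apply_ne_top i⟩)

theorem finite_support_channelLaw (μ : PMF I) (W : I → PMF B) (hμ : μ.support.Finite)
    (hW : ∀ i, (W i).support.Finite) : (channelLaw μ W).support.Finite := by
  simp only [channelLaw, PMF.support_bind, PMF.support_map]
  exact hμ.biUnion fun i _ => (hW i).image _

end Channel

theorem condEntropy_channelLaw_comp {B I J : Type} (μ : PMF I) (hμ : μ.support.Finite)
    (W : J → PMF B) (hW : ∀ j, (W j).support.Finite) (φ : I → J) :
    condEntropy (channelLaw μ (W ∘ φ)) = condEntropy (channelLaw (μ.map φ) W) := by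
  have hfin := finite_support_channelLaw μ (W ∘ φ) hμ fun i => hW (φ i)
  have hs := hfin.coe_toFinset.ge
  rw [← channelLaw_map_prodMap, condEntropy_eq_sum _ hs, condEntropy_map_eq_sum _ hs]
  congr 1
  refine Finset.sum_congr rfl fun ⟨b, i⟩ hz => ?_
  have hi : μ i ≠ 0 := left_ne_zero_of_mul <|
    channelLaw_apply μ (W ∘ φ) b i ▸ (PMF.mem_support_iff _ _).1 (hfin.mem_toFinset.1 hz)
  have hφi : μ.map φ (φ i) ≠ 0 := (PMF.mem_support_map_iff ..).2 ⟨i, hi, rfl⟩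
  rw [channelLaw_map_prodMap, condProb_channelLaw μ _ b hi, Prod.map_apply, id_eq,
    condProb_channelLaw _ W b hφi, Function.comp_apply]

/- The data processing inequality for `I(input ; output | f input)`. Given the input, the output has
the same entropy on both sides, since it depends on the input only through `φ`; given `f input` it
has less entropy than given `ψ (f input)`. -/
theorem condEntropy_channelLaw_sub_le {B C D I J : Type} (μ : PMF I) (hμ : μ.support.Finite)
    (W : J → PMF B) (hW : ∀ j, (W j).support.Finite) {φ : I → J} {f : I → C} {g : J → D}
    {ψ : C → D} (hcomm : g ∘ φ = ψ ∘ f) :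
    condEntropy ((channelLaw μ (W ∘ φ)).map (Prod.map id f)) - condEntropy (channelLaw μ (W ∘ φ)) ≤
      condEntropy ((channelLaw (μ.map φ) W).map (Prod.map id g)) -
        condEntropy (channelLaw (μ.map φ) W) := by
  have hfin : ((channelLaw μ (W ∘ φ)).map (Prod.map id f)).support.Finite := by
    rw [PMF.support_map]
    exact (finite_support_channelLaw μ (W ∘ φ) hμ fun i => hW (φ i)).image _
  have htranslate : (channelLaw (μ.map φ) W).map (Prod.map id g) =
      ((channelLaw μ (W ∘ φ)).map (Prod.map id f)).map (Prod.map id ψ) := by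
    rw [← channelLaw_map_prodMap, PMF.map_comp, PMF.map_comp, Prod.map_comp_map,
      Prod.map_comp_map, hcomm]
  rw [htranslate, condEntropy_channelLaw_comp μ hμ W hW φ]
  exact sub_le_sub_right (condEntropy_le_condEntropy_map _ hfin ψ) _

/-! ### Translating the inputs of a protocol -/

namespace PrivateCoinProtocol

variable {X Y X' Y' : Type}

/-- The protocol tree in which Alice applies `φ`, and Bob `ψ`, to the input before following the
given tree. -/
def comap (φ : X' → X) (ψ : Y' → Y) : PrivateCoinProtocol X Y → PrivateCoinProtocol X' Y'
  | leaf out => leaf out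
  | alice msg next => alice (msg ∘ φ) fun b => comap φ ψ (next b)
  | bob msg next => bob (msg ∘ ψ) fun b => comap φ ψ (next b)

theorem depth_comap (φ : X' → X) (ψ : Y' → Y) (P : PrivateCoinProtocol X Y) :
    (P.comap φ ψ).depth = P.depth := by
  induction P with
  | leaf out => rfl
  | alice msg next ih | bob msg next ih => simp only [comap, depth, ih]

theorem run_comap (φ : X' → X) (ψ : Y' → Y) (P : PrivateCoinProtocol X Y) (x : X') (y : Y') :
    (P.comap φ ψ).run x y = P.run (φ x) (ψ y) := by
  induction P with
  | leaf out => rfl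
  | alice msg next ih | bob msg next ih => simp only [comap, run, ih, Function.comp_apply]

theorem finite_support_run (P : PrivateCoinProtocol X Y) (x : X) (y : Y) :
    (P.run x y).support.Finite := by
  induction P with
  | leaf out => simp [run]
  | alice msg next ih | bob msg next ih =>
    simp only [run, PMF.support_bind, PMF.support_map]
    exact (Set.toFinite _).biUnion fun b _ => (ih b).image _

end PrivateCoinProtocol

namespace RandomizedProtocol

variable {X Y X' Y' : Type}

/-- The protocol in which Alice applies `φ`, and Bob `ψ`, to the input before running the given
protocol. -/
def comap (φ : X' → X) (ψ : Y' → Y) (P : RandomizedProtocol X Y) : RandomizedProtocol X' Y' where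
  numSeeds := P.numSeeds
  coins := P.coins
  tree r := (P.tree r).comap φ ψ

theorem cost_comap (φ : X' → X) (ψ : Y' → Y) (P : RandomizedProtocol X Y) :
    (P.comap φ ψ).cost = P.cost :=
  congrArg Finset.univ.sup (funext fun r => (P.tree r).depth_comap φ ψ)

theorem output_comap (φ : X' → X) (ψ : Y' → Y) (P : RandomizedProtocol X Y) (x : X') (y : Y') :
    (P.comap φ ψ).output x y = P.output (φ x) (ψ y) := by
  simp only [output, comap, PrivateCoinProtocol.run_comap]

theorem transcript_comap (φ : X' → X) (ψ : Y' → Y) (P : RandomizedProtocol X Y) (x : X')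
    (y : Y') : (P.comap φ ψ).transcript x y = P.transcript (φ x) (ψ y) := by
  simp only [transcript, comap, PrivateCoinProtocol.run_comap]

theorem finite_support_transcript (P : RandomizedProtocol X Y) (x : X) (y : Y) :
    (P.transcript x y).support.Finite := by
  simp only [transcript, PMF.support_bind, PMF.support_map]
  exact (Set.toFinite _).biUnion fun r _ => ((P.tree r).finite_support_run x y).image _

theorem jointLaw_eq_map_channelLaw (P : RandomizedProtocol X Y) (μ : PMF (X × Y)) :
    P.jointLaw μ =
      (channelLaw μ (Function.uncurry P.transcript)).map fun t => (t.2.1, t.2.2, t.1) := by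
  simp only [jointLaw, channelLaw, PMF.map_bind, PMF.map_comp, Function.comp_def,
    Function.uncurry_def]

theorem infoCost_eq_condEntropy (P : RandomizedProtocol X Y) (μ : PMF (X × Y)) :
    P.infoCost μ =
      (condEntropy ((channelLaw μ (Function.uncurry P.transcript)).map (Prod.map id Prod.snd)) -
        condEntropy (channelLaw μ (Function.uncurry P.transcript))) +
      (condEntropy ((channelLaw μ (Function.uncurry P.transcript)).map (Prod.map id Prod.fst)) -
        condEntropy (channelLaw μ (Function.uncurry P.transcript))) := by
  set L := channelLaw μ (Function.uncurry P.transcript) with hL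
  have hswap : condEntropy (L.map fun t => (t.1, t.2.2, t.2.1)) = condEntropy L :=
    condEntropy_map_prodMap_equiv L (Equiv.prodComm X Y)
  have hid : (L.map fun t => (t.1, t.2.1, t.2.2)) = L := PMF.map_id L
  simp only [infoCost, condMutualInfo_eq_condEntropy_sub, jointLaw_eq_map_channelLaw, ← hL,
    PMF.map_comp, Function.comp_def, hswap, hid]
  rfl

theorem infoCost_comap_le (φ : X' → X) (ψ : Y' → Y) (P : RandomizedProtocol X Y)
    {μ : PMF (X' × Y')} (hμ : μ.support.Finite) :
    (P.comap φ ψ).infoCost μ ≤ P.infoCost (μ.map (Prod.map φ ψ)) := by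
  have htranscript : Function.uncurry (P.comap φ ψ).transcript =
      Function.uncurry P.transcript ∘ Prod.map φ ψ :=
    funext fun z => P.transcript_comap φ ψ z.1 z.2
  have hfin (z : X × Y) : (Function.uncurry P.transcript z).support.Finite :=
    P.finite_support_transcript z.1 z.2
  rw [infoCost_eq_condEntropy, infoCost_eq_condEntropy, htranscript]
  exact add_le_add (condEntropy_channelLaw_sub_le μ hμ _ hfin rfl)
    (condEntropy_channelLaw_sub_le μ hμ _ hfin rfl)

end RandomizedProtocol

/-! ### Pullbacks and Hamming weights -/

namespace PartialBoolFun

variable {m n : ℕ} {φ ψ : (Fin m → Bool) → (Fin n → Bool)}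

/-- The pullback of a partial function along maps `φ` and `ψ` of Alice's and Bob's inputs. -/
def comap (φ ψ : (Fin m → Bool) → (Fin n → Bool)) (g : PartialBoolFun n) : PartialBoolFun m :=
  fun x y => g (φ x) (ψ y)

theorem permInvariant_comap (hφ : ∀ (π : Equiv.Perm (Fin m)) x, φ (x ∘ π) = φ x)
    (hψ : ∀ (π : Equiv.Perm (Fin m)) y, ψ (y ∘ π) = ψ y) (g : PartialBoolFun n) :
    (g.comap φ ψ).PermInvariant :=
  fun π x y => congrArg₂ g (hφ π x) (hψ π y)

theorem comap_surjInv (hφ : φ.Surjective) (hψ : ψ.Surjective) (g : PartialBoolFun n) :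
    (g.comap φ ψ).comap (Function.surjInv hφ) (Function.surjInv hψ) = g :=
  funext₂ fun x y => congrArg₂ g (Function.surjInv_eq hφ x) (Function.surjInv_eq hψ y)

theorem ComputedBy.comap {g : PartialBoolFun n}
    {P : RandomizedProtocol (Fin n → Bool) (Fin n → Bool)} (hP : g.ComputedBy P)
    (φ ψ : (Fin m → Bool) → (Fin n → Bool)) : (g.comap φ ψ).ComputedBy (P.comap φ ψ) :=
  fun x y b hb => by
    rw [P.output_comap]
    exact hP _ _ b hb

/-- The costs of the protocols computing `g`, so that `g.R` is `sInf g.costs`. -/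
def costs (g : PartialBoolFun n) : Set ℕ := {c | ∃ P, g.ComputedBy P ∧ P.cost = c}

theorem costs_subset_costs_comap (φ ψ : (Fin m → Bool) → (Fin n → Bool)) (g : PartialBoolFun n) :
    g.costs ⊆ (g.comap φ ψ).costs := by
  rintro _ ⟨P, hP, rfl⟩
  exact ⟨P.comap φ ψ, hP.comap φ ψ, P.cost_comap φ ψ⟩

theorem R_comap (hφ : φ.Surjective) (hψ : ψ.Surjective) (g : PartialBoolFun n) :
    (g.comap φ ψ).R = g.R := by
  have hge := (g.comap φ ψ).costs_subset_costs_comap (Function.surjInv hφ) (Function.surjInv hψ)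
  rw [comap_surjInv] at hge
  exact congrArg sInf (hge.antisymm (g.costs_subset_costs_comap φ ψ))

/-- The information complexity as an extended real, whose `EReal.toReal` is `IC`. In this form
monotonicity needs no finiteness. -/
noncomputable def extendedIC (g : PartialBoolFun n) : EReal :=
  ⨅ (P : RandomizedProtocol (Fin n → Bool) (Fin n → Bool)) (_ : g.ComputedBy P),
    ⨆ μ : PMF ((Fin n → Bool) × (Fin n → Bool)), (P.infoCost μ : EReal)

theorem extendedIC_comap_le (φ ψ : (Fin m → Bool) → (Fin n → Bool)) (g : PartialBoolFun n) :
    (g.comap φ ψ).extendedIC ≤ g.extendedIC := by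
  refine le_iInf₂ fun P hP => iInf₂_le_of_le (P.comap φ ψ) (hP.comap φ ψ) (iSup_le fun μ => ?_)
  exact le_iSup_of_le (μ.map (Prod.map φ ψ))
    (EReal.coe_le_coe_iff.2 (P.infoCost_comap_le φ ψ (Set.toFinite _)))

theorem IC_comap (hφ : φ.Surjective) (hψ : ψ.Surjective) (g : PartialBoolFun n) :
    (g.comap φ ψ).IC = g.IC := by
  have hge := (g.comap φ ψ).extendedIC_comap_le (Function.surjInv hφ) (Function.surjInv hψ)
  rw [comap_surjInv] at hge
  exact congrArg EReal.toReal ((g.extendedIC_comap_le φ ψ).antisymm hge)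

end PartialBoolFun

/-- The Hamming weight of a bit string (Mathlib's `hammingNorm` needs a zero, which `Bool` does
not have). -/
def hammingWeight {m : ℕ} (x : Fin m → Bool) : ℕ := Finset.card {i | x i = true}

theorem hammingWeight_comp_perm {m : ℕ} (x : Fin m → Bool) (π : Equiv.Perm (Fin m)) :
    hammingWeight (x ∘ π) = hammingWeight x :=
  Finset.card_equiv π (by simp)

theorem exists_hammingWeight_eq {m k : ℕ} (hk : k ≤ m) :
    ∃ x : Fin m → Bool, hammingWeight x = k :=
  ⟨fun i => decide (i.val < k), by simp [hammingWeight, Fin.card_filter_val_lt, hk]⟩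

theorem exists_surjective_perm_invariant {m : ℕ} (α : Type*) [Fintype α] [Nonempty α]
    (hα : Fintype.card α ≤ m + 1) :
    ∃ d : (Fin m → Bool) → α, d.Surjective ∧
      ∀ (π : Equiv.Perm (Fin m)) x, d (x ∘ π) = d x := by
  let code : α → ℕ := fun a => Fintype.equivFin α a
  have hcode : code.Injective := Fin.val_injective.comp (Fintype.equivFin α).injective
  refine ⟨code.invFun ∘ hammingWeight, fun a => ?_, fun π x => ?_⟩
  · have hle : code a ≤ m := Nat.le_of_lt_succ ((Fintype.equivFin α a).isLt.trans_le hα)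
    obtain ⟨x, hx⟩ := exists_hammingWeight_eq hle
    exact ⟨x, by rw [Function.comp_apply, hx, Function.leftInverse_invFun hcode]⟩
  · exact congrArg code.invFun (hammingWeight_comp_perm x π)

theorem mainTheorem11_general (F : ℝ → ℝ → ℝ)
    (hF : ∀ n : ℕ, 1 ≤ n → ∀ f : PartialBoolFun n, f.PermInvariant →
      (f.R : ℝ) ≤ F f.IC (Real.logb 2 n)) :
    ∀ (n : ℕ) (g : PartialBoolFun n), (g.R : ℝ) ≤ F g.IC n := by
  intro n g
  obtain ⟨decode, hsurj, hperm⟩ :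
      ∃ d : (Fin (2 ^ n) → Bool) → (Fin n → Bool), d.Surjective ∧
        ∀ (π : Equiv.Perm (Fin (2 ^ n))) x, d (x ∘ π) = d x :=
    exists_surjective_perm_invariant _ (by simp)
  have hlog : Real.logb 2 ((2 ^ n : ℕ) : ℝ) = n := by
    rw [Nat.cast_pow, Nat.cast_ofNat, Real.logb_pow, Real.logb_self_eq_one one_lt_two, mul_one]
  have hbound := hF (2 ^ n) Nat.one_le_two_pow _ (g.permInvariant_comap hperm hperm)
  rwa [g.R_comap hsurj hsurj, g.IC_comap hsurj hsurj, hlog] at hbound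

theorem mainTheorem11 (G : ℝ → ℝ) (p : Polynomial ℝ)
    (hG : ∀ n : ℕ, 1 ≤ n → ∀ f : PartialBoolFun n, f.PermInvariant →
      (f.R : ℝ) ≤ p.eval f.IC + G (Real.logb 2 n)) :
    ∀ (n : ℕ) (g : PartialBoolFun n), (g.R : ℝ) ≤ p.eval g.IC + G n :=
  mainTheorem11_general (fun c t => p.eval c + G t) hG
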